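/- Let $q\in(-1,1)$. For a complex Hilbert space $\mathcal V$ (inner product conjugate-linear in the first variable) and a unital $C^*$-algebra $\mathcal A$, a *representation of the $q$-relations* is a $\mathbb C$-linear map $r:\mathcal V\to\mathcal A$ such that $$r(f)\,r(g)^{*}-q\,r(g)^{*}\,r(f)=\langle g,f\rangle\,\mathbb I\qquad\text{for all } f,g\in\mathcal V .$$ All $*$-homomorphisms below are unital. A representation $r:\mathcal V\to\mathfrak C$ is called *universal* if for every unital $C^*$-algebra $\mathcal A$ and every representation $\tilde r:\mathcal V\to\mathcal A$ of the $q$-relations there is a unique $*$-homomorphism $\tilde\beta:\mathfrak C\to\mathcal A$ with $\tilde\beta(r(f))=\tilde r(f)$ for all $f\in\mathcal V$. 1. For every complex Hilbert space $\mathcal V$ there exist a nonzero unital $C^*$-algebra $\mathfrak C^q(\mathcal V)$ and a universal representation $r:\mathcal V\to\mathfrak C^q(\mathcal V)$ of the $q$-relations. 2. The algebra $\mathfrak C^q(\mathcal V)$ is determined up to isomorphism: if $r_1:\mathcal V\to\mathfrak C_1$ and $r_2:\mathcal V\to\mathfrak C_2$ are universal representations, there is a unique $*$-isomorphism $\varphi:\mathfrak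 C_1\to\mathfrak C_2$ with $\varphi(r_1(f))=r_2(f)$ for all $f\in\mathcal V$. For every linear isometry $H:\mathcal V_1\to\mathcal V_2$ between complex Hilbert spaces there is a unique $*$-homomorphism $\mathfrak C^q(H):\mathfrak C^q(\mathcal V_1)\to\mathfrak C^q(\mathcal V_2)$ with $\mathfrak C^q(H)(r(f))=r(Hf)$ for all $f\in\mathcal V_1$. Moreover $\mathfrak C^q(\mathrm{id}_{\mathcal V})=\mathrm{id}$ and $\mathfrak C^q(KH)=\mathfrak C^q(K)\,\mathfrak C^q(H)$ for linear isometries $H:\mathcal V_1\to\mathcal V_2$ and $K:\mathcal V_2\to\mathcal V_3$. -/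

import Mathlib

universe w u v

/-- A representation of the `q`-relations of the complex inner product space `V` in the unital
C⋆-algebra `A`: a `ℂ`-linear map `r : V → A` with
`r(f) r(g)⋆ - q r(g)⋆ r(f) = ⟨g, f⟩ 1` for all `f, g`.
The inner product is conjugate-linear in its first argument, so that both sides are linear in `f`
and conjugate-linear in `g`. -/
def IsQRep {V A : Type*} [NormedAddCommGroup V] [InnerProductSpace ℂ V] [CStarAlgebra A]
    (q : ℝ) (r : V →ₗ[ℂ] A) : Prop :=
  ∀ f g : V, r f * star (r g) - (q : ℂ) • (star (r g) * r f) = inner ℂ g f • (1 : A)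

/-- `r : V → C` is a universal representation of the `q`-relations: it is a representation, and
every representation `s : V → A` in a unital C⋆-algebra `A : Type w` factors through it by a
unique unital `⋆`-homomorphism `β : C → A`. -/
def IsUniversalQRep {V : Type u} {C : Type v} [NormedAddCommGroup V]
    [InnerProductSpace ℂ V] [CStarAlgebra C] (q : ℝ) (r : V →ₗ[ℂ] C) : Prop :=
  IsQRep q r ∧
    ∀ (A : Type w) [CStarAlgebra A] (s : V →ₗ[ℂ] A), IsQRep q s →
      ∃! β : C →⋆ₐ[ℂ] A, ∀ f : V, β (r f) = s f

/-! Universality is obtained by taking the C⋆-algebra generated by the direct sum of all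
representations. Two points make this legitimate. The C⋆-identity bounds `‖r f‖ ^ 2` by `‖f‖ ^ 2 /
(1 - |q|)` in every representation (`IsQRep.norm_sq_le`), so the direct sum is a bounded family. And
a C⋆-algebra generated by the image of `V` injects into a fixed type built from `V`
(`exists_injective_cstarClosure`), so a family of representations indexed by a small type suffices.
Uniqueness and functoriality then follow formally from the universal property.

That the algebra is nonzero needs one nonzero representation: annihilation operators on the `q`-Fock
space. The main point is positivity of the `q`-inner product, which reduces to positivity of `q ^
inv (τ σ⁻¹)` on the symmetric group (`posSemidef_invWeight`). This kernel is an entrywise product,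
over pairs of positions, of elementary positive kernels, so the Schur product theorem applies.
Semidefiniteness is enough, since completing a seminormed space identifies null vectors with zero.
-/

open scoped ComplexOrder Matrix ENNReal CStarAlgebra

/-! ### Positive semidefinite kernels and the inversion weight -/

/-- The weight `q ^ inv ρ`, written as a product over all inversions of the permutation `ρ`. -/
noncomputable def invWeight (q : ℝ) {n : ℕ} (ρ : Equiv.Perm (Fin n)) : ℂ :=
  ∏ i, ∏ j, if i < j ∧ ρ j < ρ i then (q : ℂ) else 1

theorem prod_prod_eq_prod_prod_lt {ι M : Type*} [Fintype ι] [LinearOrder ι] [CommMonoid M]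
    (F : ι → ι → M) (hF : ∀ i, F i i = 1) :
    ∏ i, ∏ j, F i j = ∏ i, ∏ j, if i < j then F i j * F j i else 1 := by
  have h : ∀ i j, F i j = (if i < j then F i j else 1) * (if j < i then F i j else 1) := by
    intro i j
    rcases lt_trichotomy i j with h | h | h
    · simp [h, h.not_gt]
    · subst h; simp [hF]
    · simp [h, h.not_gt]
  calc ∏ i, ∏ j, F i j
      = ∏ i, ∏ j, (if i < j then F i j else 1) * (if j < i then F i j else 1) :=
        Finset.prod_congr rfl fun i _ => Finset.prod_congr rfl fun j _ => h i j
    _ = (∏ i, ∏ j, if i < j then F i j else 1) * ∏ i, ∏ j, if i < j then F j i else 1 := by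
        simp_rw [Finset.prod_mul_distrib]
        rw [Finset.prod_comm (f := fun i j => if j < i then F i j else 1)]
    _ = _ := by
        simp_rw [← Finset.prod_mul_distrib]
        refine Finset.prod_congr rfl fun i _ => Finset.prod_congr rfl fun j _ => ?_
        split_ifs <;> simp

/-- A pair of positions `k < l` gives an inversion of `τ * σ⁻¹` exactly when `σ` and `τ` order it
differently. Each factor thus compares a two-valued function of `σ` with the same function of `τ`.
-/
theorem invWeight_mul_inv (q : ℝ) {n : ℕ} (σ τ : Equiv.Perm (Fin n)) :
    invWeight q (τ * σ⁻¹) = ∏ k, ∏ l, if k < l then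
      (if (σ k < σ l ↔ τ k < τ l) then 1 else (q : ℂ)) else 1 := by
  have h : invWeight q (τ * σ⁻¹) =
      ∏ k, ∏ l, if σ k < σ l ∧ τ l < τ k then (q : ℂ) else 1 := by
    rw [invWeight, ← Equiv.prod_comp σ]
    refine Finset.prod_congr rfl fun k _ => ?_
    rw [← Equiv.prod_comp σ]
    simp
  rw [h, prod_prod_eq_prod_prod_lt _ (by simp)]
  refine Finset.prod_congr rfl fun k _ => Finset.prod_congr rfl fun l _ => ?_
  split_ifs with hkl h1 h2 h3 h4 h5 h6 h7 <;> try rfl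
  all_goals
    have h8 : σ k ≠ σ l := fun h => hkl.ne (σ.injective h)
    have h9 : τ k ≠ τ l := fun h => hkl.ne (τ.injective h)
    grind

/-- Positivity is tested on finitely supported vectors, so kernels on infinite types reduce to
finite matrices. -/
theorem Matrix.posSemidef_of_submatrix {ι : Type*} {M : Matrix ι ι ℂ}
    (h : ∀ s : Finset ι, (M.submatrix (fun i : s => (i : ι)) (fun i : s => (i : ι))).PosSemidef) :
    M.PosSemidef := by
  classical
  refine ⟨?_, fun x => ?_⟩
  · ext i j
    exact (h {i, j}).1.apply ⟨i, by simp⟩ ⟨j, by simp⟩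
  · simpa [Finsupp.sum, ← Finset.sum_attach x.support, ← Finset.subtype_mem_eq_attach,
      ← Finsupp.subtypeDomain_apply, ← Finsupp.support_subtypeDomain] using (h x.support).2 _

theorem Matrix.posSemidef_inner {ι E : Type*} [NormedAddCommGroup E] [InnerProductSpace ℂ E]
    (v : ι → E) : (Matrix.of fun i j => inner ℂ (v j) (v i)).PosSemidef :=
  Matrix.posSemidef_of_submatrix fun s =>
    (Matrix.posSemidef_gram ℂ fun i : s => v i).transpose

theorem Matrix.posSemidef_prod {ι κ : Type*} (s : Finset κ) (M : κ → Matrix ι ι ℂ)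
    (hM : ∀ k ∈ s, (M k).PosSemidef) :
    (Matrix.of fun i j => ∏ k ∈ s, M k i j).PosSemidef := by
  classical
  induction s using Finset.induction_on with
  | empty =>
    have h : (Matrix.of fun i j : ι => ∏ k ∈ (∅ : Finset κ), M k i j) =
        Matrix.of fun _ _ => inner ℂ (1 : ℂ) 1 := by ext i j; simp
    exact h ▸ Matrix.posSemidef_inner fun _ => 1
  | insert a s ha ih =>
    have h : (Matrix.of fun i j : ι => ∏ k ∈ insert a s, M k i j) =
        M a ⊙ Matrix.of fun i j => ∏ k ∈ s, M k i j := by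
      ext i j; simp [Finset.prod_insert ha]
    exact h ▸ (hM a (by simp)).hadamard (ih fun k hk => hM k (by simp [hk]))

/-- With signs `ε = ±1` recording `p`, the kernel is `(1 + q) / 2 + (1 - q) / 2 * ε i * ε j`, a
convex combination of two rank-one positive kernels. -/
theorem posSemidef_ite_iff {ι : Type*} {q : ℝ} (h₁ : -1 ≤ q) (h₂ : q ≤ 1) (p : ι → Prop)
    [DecidablePred p] :
    (Matrix.of fun i j => if (p i ↔ p j) then 1 else (q : ℂ)).PosSemidef := by
  have hA := (Matrix.posSemidef_inner fun _ : ι => (1 : ℂ)).smul (a := (1 + q) / 2) (by linarith)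
  have hB := (Matrix.posSemidef_inner fun i : ι => if p i then (1 : ℂ) else -1).smul
    (a := (1 - q) / 2) (by linarith)
  have h : (Matrix.of fun i j : ι => if (p i ↔ p j) then 1 else (q : ℂ)) =
      ((1 + q) / 2 : ℝ) • (Matrix.of fun _ _ => inner ℂ (1 : ℂ) 1) + ((1 - q) / 2 : ℝ) •
        (Matrix.of fun i j => inner ℂ (if p j then (1 : ℂ) else -1) (if p i then 1 else -1)) := by
    ext i j
    by_cases hi : p i <;> by_cases hj : p j <;> simp [hi, hj] <;> ring
  exact h ▸ hA.add hB

theorem Matrix.PosSemidef.sum_sum {X S : Type*} [Fintype S] {M : Matrix (X × S) (X × S) ℂ}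
    (hM : M.PosSemidef) :
    (Matrix.of fun x y => ∑ σ, ∑ τ, M (x, σ) (y, τ)).PosSemidef := by
  classical
  refine Matrix.posSemidef_of_submatrix fun s => ?_
  -- Summing over `S` is the compression `Bᴴ * M * B`, where `B` is the incidence matrix of the
  -- first projection.
  have h := (hM.submatrix fun z : s × S => ((z.1 : X), z.2)).conjTranspose_mul_mul_same
    (Matrix.of fun (z : s × S) (x : s) => if z.1 = x then (1 : ℂ) else 0)
  convert h using 1
  ext x y
  simp [Matrix.mul_apply, Fintype.sum_prod_type, apply_ite]
  rw [Finset.sum_comm]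

theorem posSemidef_invWeight {q : ℝ} (h₁ : -1 ≤ q) (h₂ : q ≤ 1) (n : ℕ) :
    (Matrix.of fun σ τ : Equiv.Perm (Fin n) => invWeight q (τ * σ⁻¹)).PosSemidef := by
  simp_rw [invWeight_mul_inv]
  refine Matrix.posSemidef_prod Finset.univ
    (fun k => Matrix.of fun σ τ : Equiv.Perm (Fin n) => ∏ l, if k < l then
      (if (σ k < σ l ↔ τ k < τ l) then 1 else (q : ℂ)) else 1) fun k _ => ?_
  refine Matrix.posSemidef_prod Finset.univ
    (fun l => Matrix.of fun σ τ : Equiv.Perm (Fin n) => if k < l then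
      (if (σ k < σ l ↔ τ k < τ l) then 1 else (q : ℂ)) else 1) fun l _ => ?_
  by_cases hkl : k < l
  · simpa [hkl] using posSemidef_ite_iff h₁ h₂ fun σ : Equiv.Perm (Fin n) => σ k < σ l
  · simpa [hkl] using Matrix.posSemidef_inner fun _ : Equiv.Perm (Fin n) => (1 : ℂ)

/-! ### The `q`-deformed inner product and its positivity -/

section QKernel

variable {V : Type*} [NormedAddCommGroup V] [InnerProductSpace ℂ V]

/-- The `q`-deformed inner product of two elementary `n`-particle vectors, each given by the first
`n` entries of a sequence. -/
noncomputable def qKernelOn (q : ℝ) (n : ℕ) (u w : ℕ → V) : ℂ :=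
  ∑ ρ : Equiv.Perm (Fin n), invWeight q ρ * ∏ i : Fin n, inner ℂ (w (ρ i)) (u i)

/-- Symmetrizing over `σ` exhibits the form as a double sum of an entrywise product of the group
kernel and a product of Gram kernels, where Schur's theorem applies. -/
theorem factorial_mul_qKernelOn (q : ℝ) (n : ℕ) (u w : ℕ → V) :
    (n.factorial : ℂ) * qKernelOn q n u w = ∑ σ : Equiv.Perm (Fin n), ∑ τ : Equiv.Perm (Fin n),
      invWeight q (τ * σ⁻¹) * ∏ i : Fin n, inner ℂ (w (τ i)) (u (σ i)) := by
  have h : ∀ σ : Equiv.Perm (Fin n), ∑ τ : Equiv.Perm (Fin n),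
      invWeight q (τ * σ⁻¹) * ∏ i : Fin n, inner ℂ (w (τ i)) (u (σ i)) = qKernelOn q n u w := by
    intro σ
    rw [qKernelOn, ← Equiv.sum_comp (Equiv.mulRight σ⁻¹) fun ρ : Equiv.Perm (Fin n) =>
      invWeight q ρ * ∏ i : Fin n, inner ℂ (w (ρ i)) (u i)]
    refine Finset.sum_congr rfl fun τ _ => ?_
    rw [← Equiv.prod_comp σ fun i : Fin n => inner ℂ (w ((Equiv.mulRight σ⁻¹ τ) i)) (u i)]
    simp
  simp [h, Fintype.card_perm]

theorem posSemidef_qKernelOn {q : ℝ} (h₁ : -1 ≤ q) (h₂ : q ≤ 1) (n : ℕ) :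
    (Matrix.of fun u w : ℕ → V => qKernelOn q n u w).PosSemidef := by
  have hG : (Matrix.of fun x y : (ℕ → V) × Equiv.Perm (Fin n) =>
      ∏ i : Fin n, inner ℂ (y.1 (y.2 i)) (x.1 (x.2 i))).PosSemidef :=
    Matrix.posSemidef_prod Finset.univ
      (fun i : Fin n => Matrix.of fun x y : (ℕ → V) × Equiv.Perm (Fin n) =>
        inner ℂ (y.1 (y.2 i)) (x.1 (x.2 i)))
      fun i _ => Matrix.posSemidef_inner fun x : (ℕ → V) × Equiv.Perm (Fin n) => x.1 (x.2 i)
  have h := ((((posSemidef_invWeight h₁ h₂ n).submatrix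
    (Prod.snd : (ℕ → V) × Equiv.Perm (Fin n) → _)).hadamard hG).sum_sum).smul
    (a := ((n.factorial : ℝ))⁻¹) (by positivity)
  convert h using 1
  ext u w
  have hn : (n.factorial : ℂ) ≠ 0 := by exact_mod_cast n.factorial_ne_zero
  have := factorial_mul_qKernelOn q n u w
  simp only [Matrix.of_apply, Matrix.smul_apply, Matrix.hadamard_apply, Matrix.submatrix_apply]
  rw [← this]
  simp [hn]

/-- The `q`-deformed inner product of elementary vectors `(n, u)`, where only the first `n` entries
of the sequence `u` matter. -/
noncomputable def qKernel (q : ℝ) (x y : ℕ × (ℕ → V)) : ℂ :=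
  if x.1 = y.1 then qKernelOn q x.1 x.2 y.2 else 0

theorem posSemidef_qKernel {q : ℝ} (h₁ : -1 ≤ q) (h₂ : q ≤ 1) :
    (Matrix.of fun x y : ℕ × (ℕ → V) => qKernel q x y).PosSemidef := by
  refine Matrix.posSemidef_of_submatrix fun s => ?_
  have h : ∀ n : ℕ, ((Matrix.of fun x y : ℕ × (ℕ → V) =>
        inner ℂ (if y.1 = n then (1 : ℂ) else 0) (if x.1 = n then 1 else 0)) ⊙
      (Matrix.of fun u w : ℕ → V => qKernelOn q n u w).submatrix Prod.snd Prod.snd).PosSemidef :=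
    fun n => (Matrix.posSemidef_inner fun x : ℕ × (ℕ → V) => if x.1 = n then (1 : ℂ) else 0).hadamard
      ((posSemidef_qKernelOn h₁ h₂ n).submatrix Prod.snd)
  -- A finite index set meets only finitely many particle numbers, so the block-diagonal kernel is a
  -- finite sum of its blocks there.
  have h' := (Matrix.posSemidef_sum (s.image Prod.fst) fun n _ => h n).submatrix
    (fun i : s => (i : ℕ × (ℕ → V)))
  convert h' using 1
  ext x y
  simp only [Matrix.submatrix_apply, Matrix.sum_apply, Matrix.hadamard_apply, Matrix.of_apply]
  rw [Finset.sum_eq_single (x : ℕ × (ℕ → V)).1]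
  · by_cases hxy : (x : ℕ × (ℕ → V)).1 = (y : ℕ × (ℕ → V)).1
    · simp [qKernel, hxy]
    · simp [qKernel, hxy, Ne.symm hxy]
  · intro n _ hn
    simp [hn.symm]
  · intro hx
    exact absurd (Finset.mem_image_of_mem _ x.2) hx

/-! ### Recursion for the kernel: splitting off the first entry -/

/-- The permutation of `Fin (n + 1)` that maps `0` to `j` and acts as `ρ` on the remaining points,
the complements of `0` and of `j` being identified with `Fin n` in an order preserving way. -/
def permCons {n : ℕ} (j : Fin (n + 1)) (ρ : Equiv.Perm (Fin n)) : Equiv.Perm (Fin (n + 1)) :=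
  j.cycleRange.symm * Equiv.Perm.decomposeFin.symm (0, ρ)

@[simp] theorem permCons_zero {n : ℕ} (j : Fin (n + 1)) (ρ : Equiv.Perm (Fin n)) :
    permCons j ρ 0 = j := by
  simp [permCons]

@[simp] theorem permCons_succ {n : ℕ} (j : Fin (n + 1)) (ρ : Equiv.Perm (Fin n)) (i : Fin n) :
    permCons j ρ i.succ = j.succAbove (ρ i) := by
  simp [permCons]

theorem permCons_bijective (n : ℕ) : Function.Bijective
    fun p : Fin (n + 1) × Equiv.Perm (Fin n) => permCons p.1 p.2 := by
  rw [Fintype.bijective_iff_injective_and_card]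
  refine ⟨?_, by simp [Fintype.card_perm, Nat.factorial_succ]⟩
  rintro ⟨j, ρ⟩ ⟨j', ρ'⟩ h
  have h0 : j = j' := by simpa using congrArg (fun σ => σ 0) h
  subst h0
  refine Prod.ext rfl (Equiv.ext fun i => ?_)
  simpa using congrArg (fun σ => σ i.succ) h

/-- The value `j` in position `0` precedes all `j` smaller values, giving `j` inversions;
`Fin.succAbove` preserves order, so the others are those of `ρ`. -/
theorem invWeight_permCons (q : ℝ) {n : ℕ} (j : Fin (n + 1)) (ρ : Equiv.Perm (Fin n)) :
    invWeight q (permCons j ρ) = (q : ℂ) ^ (j : ℕ) * invWeight q ρ := by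
  rw [invWeight, invWeight, Fin.prod_univ_succ, Fin.prod_univ_succ]
  simp only [Fin.prod_univ_succ (n := n), permCons_zero, permCons_succ, Fin.succ_lt_succ_iff,
    Fin.succ_pos, true_and, lt_irrefl, false_and, if_false, one_mul, Fin.not_lt_zero,
    Fin.succAbove_lt_succAbove_iff]
  congr 1
  rw [Equiv.prod_comp ρ fun l => if j.succAbove l < j then (q : ℂ) else 1]
  simp only [Fin.succAbove_lt_iff_castSucc_lt, Finset.prod_ite, Finset.prod_const, one_pow, mul_one]
  congr 1
  have h : (Finset.univ.filter fun i : Fin n => i.castSucc < j).card = min n j := by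
    simp [Fin.lt_def, Fin.card_filter_val_lt]
  rw [h, min_eq_right (Nat.le_of_lt_succ j.2)]

/-- Delete the entry number `j` of a sequence. -/
def skip {α : Type*} (j : ℕ) (w : ℕ → α) (k : ℕ) : α := if k < j then w k else w (k + 1)

/-- Put an entry in front of a sequence. -/
def seqCons {α : Type*} (f : α) (u : ℕ → α) (k : ℕ) : α := k.casesOn f u

@[simp] theorem seqCons_zero {α : Type*} (f : α) (u : ℕ → α) : seqCons f u 0 = f := rfl
@[simp] theorem seqCons_succ {α : Type*} (f : α) (u : ℕ → α) (k : ℕ) :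
  seqCons f u (k + 1) = u k := rfl

@[simp] theorem skip_zero_seqCons {α : Type*} (f : α) (u : ℕ → α) : skip 0 (seqCons f u) = u := by
  funext k; simp [skip]

@[simp] theorem skip_succ_seqCons {α : Type*} (j : ℕ) (f : α) (u : ℕ → α) :
    skip (j + 1) (seqCons f u) = seqCons f (skip j u) := by
  funext k
  cases k <;> simp [skip]

theorem skip_apply_fin {α : Type*} {n : ℕ} (j : Fin (n + 1)) (w : ℕ → α) (i : Fin n) :
    skip j w i = w (j.succAbove i) := by
  by_cases h : (i : ℕ) < j
  · simp [skip, h, Fin.succAbove, Fin.lt_def]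
  · simp [skip, h, Fin.succAbove, Fin.lt_def]

/-- Permutations are sorted by the image `j` of `0`. This is what makes creation and annihilation
mutually adjoint. -/
theorem qKernelOn_seqCons (q : ℝ) (n : ℕ) (f : V) (u w : ℕ → V) :
    qKernelOn q (n + 1) (seqCons f u) w =
      ∑ j ∈ Finset.range (n + 1), (q : ℂ) ^ j * inner ℂ (w j) f * qKernelOn q n u (skip j w) := by
  rw [qKernelOn, ← (permCons_bijective n).sum_comp (fun ρ : Equiv.Perm (Fin (n + 1)) =>
    invWeight q ρ * ∏ i : Fin (n + 1), inner ℂ (w (ρ i)) (seqCons f u i)), Fintype.sum_prod_type,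
    ← Fin.sum_univ_eq_sum_range
      (fun j => (q : ℂ) ^ j * inner ℂ (w j) f * qKernelOn q n u (skip j w))]
  refine Finset.sum_congr rfl fun j _ => ?_
  rw [qKernelOn, Finset.mul_sum]
  refine Finset.sum_congr rfl fun ρ _ => ?_
  simp only [invWeight_permCons, Fin.prod_univ_succ, permCons_zero, permCons_succ, Fin.val_zero,
    Fin.val_succ, seqCons_zero, seqCons_succ, skip_apply_fin]
  ring

end QKernel

/-! ### The algebraic `q`-Fock space -/

/-- Finite formal linear combinations of elementary `q`-Fock vectors. -/
def PreFock (_q : ℝ) (V : Type*) : Type _ := ℕ × (ℕ → V) →₀ ℂ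

namespace PreFock

section Basic

variable {V M : Type*} {q : ℝ}

noncomputable instance : AddCommGroup (PreFock q V) := inferInstanceAs (AddCommGroup (_ →₀ ℂ))
noncomputable instance : Module ℂ (PreFock q V) := inferInstanceAs (Module ℂ (_ →₀ ℂ))

/-- The vector of the `q`-Fock space given by its coefficients. -/
def ofFinsupp (q : ℝ) (x : ℕ × (ℕ → V) →₀ ℂ) : PreFock q V := x

/-- The elementary vector given by the first `n` entries of the sequence `u`. -/
noncomputable def elem (q : ℝ) (n : ℕ) (u : ℕ → V) : PreFock q V := Finsupp.single (n, u) 1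

theorem induction_elem {p : PreFock q V → Prop} (ξ : PreFock q V) (zero : p 0)
    (add : ∀ ξ η, p ξ → p η → p (ξ + η)) (smul : ∀ (c : ℂ) (n : ℕ) (u : ℕ → V), p (c • elem q n u)) :
    p ξ := by
  refine Finsupp.induction_linear (motive := p) ξ zero add fun x c => ?_
  have h : (Finsupp.single x c : ℕ × (ℕ → V) →₀ ℂ) = c • Finsupp.single x 1 := by simp
  exact (congrArg p h).mpr (smul c x.1 x.2)

theorem linearMap_ext [AddCommMonoid M] [Module ℂ M]
    {S T : PreFock q V →ₗ[ℂ] M} (h : ∀ n u, S (elem q n u) = T (elem q n u)) : S = T :=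
  Finsupp.lhom_ext' fun x => LinearMap.ext_ring (h x.1 x.2)

/-- The linear map with prescribed values on elementary vectors. -/
noncomputable def lift [AddCommGroup M] [Module ℂ M] (q : ℝ) (F : ℕ → (ℕ → V) → M) :
    PreFock q V →ₗ[ℂ] M :=
  Finsupp.linearCombination ℂ fun x => F x.1 x.2

theorem lift_elem [AddCommGroup M] [Module ℂ M] (F : ℕ → (ℕ → V) → M)
    (n : ℕ) (u : ℕ → V) : lift q F (elem q n u) = F n u :=
  (Finsupp.linearCombination_single ..).trans (one_smul ..)

/-- The creation operator. -/
noncomputable def create (q : ℝ) (f : V) : PreFock q V →ₗ[ℂ] PreFock q V :=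
  lift q fun n u => elem q (n + 1) (seqCons f u)

theorem create_elem (f : V) (n : ℕ) (u : ℕ → V) :
    create q f (elem q n u) = elem q (n + 1) (seqCons f u) := lift_elem ..

theorem lift_ofFinsupp [AddCommGroup M] [Module ℂ M] (F : ℕ → (ℕ → V) → M)
    (x : ℕ × (ℕ → V) →₀ ℂ) : lift q F (ofFinsupp q x) = x.sum fun i c => c • F i.1 i.2 :=
  Finsupp.linearCombination_apply ..

end Basic

variable {V : Type*} [NormedAddCommGroup V] [InnerProductSpace ℂ V] {q : ℝ}

/-- The annihilation operator. -/
noncomputable def annihilate (q : ℝ) (f : V) : PreFock q V →ₗ[ℂ] PreFock q V :=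
  -- For `n = 0` the sum is empty, so the truncated `n - 1` is harmless.
  lift q fun n w =>
    ∑ j ∈ Finset.range n, ((q : ℂ) ^ j * inner ℂ (w j) f) • elem q (n - 1) (skip j w)

theorem annihilate_elem (f : V) (n : ℕ) (w : ℕ → V) : annihilate q f (elem q n w) =
    ∑ j ∈ Finset.range n, ((q : ℂ) ^ j * inner ℂ (w j) f) • elem q (n - 1) (skip j w) :=
  lift_elem ..

theorem annihilate_add (f g : V) : annihilate q (f + g) = annihilate q f + annihilate q g := by
  refine linearMap_ext fun n w => ?_
  simp only [annihilate_elem, LinearMap.add_apply, inner_add_right, mul_add, add_smul,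
    Finset.sum_add_distrib]

theorem annihilate_smul (c : ℂ) (f : V) : annihilate q (c • f) = c • annihilate q f := by
  refine linearMap_ext fun n w => ?_
  simp only [annihilate_elem, inner_smul_right, LinearMap.smul_apply, Finset.smul_sum, smul_smul]
  refine Finset.sum_congr rfl fun j _ => ?_
  congr 1
  ring

/-- Deleting the new entry `g` gives the scalar term; deleting a later one costs an extra factor `q`
and leaves `g` in front. -/
theorem annihilate_comp_create (f g : V) : annihilate q f ∘ₗ create q g =
    inner ℂ g f • LinearMap.id + (q : ℂ) • (create q g ∘ₗ annihilate q f) := by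
  refine linearMap_ext fun n u => ?_
  simp only [LinearMap.comp_apply, LinearMap.add_apply, LinearMap.smul_apply, LinearMap.id_apply,
    create_elem, annihilate_elem, Finset.sum_range_succ', map_sum, map_smul, Finset.smul_sum]
  rw [add_comm]
  congr 1
  · simp
  refine Finset.sum_congr rfl fun j hj => ?_
  obtain ⟨m, rfl⟩ := Nat.exists_eq_succ_of_ne_zero (Nat.ne_zero_of_lt (Finset.mem_range.1 hj))
  simp only [smul_smul, pow_succ', seqCons_succ, skip_succ_seqCons, Nat.succ_eq_add_one,
    Nat.add_sub_cancel, mul_assoc]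

/-- The `q`-deformed sesquilinear form. -/
noncomputable def form (q : ℝ) (V : Type*) [NormedAddCommGroup V] [InnerProductSpace ℂ V] :
    PreFock q V →ₗ⋆[ℂ] PreFock q V →ₗ[ℂ] ℂ where
  -- The outer `star` makes the linear lift conjugate-linear in `ξ`; the inner one restores the
  -- value on elementary vectors.
  toFun ξ := lift q fun n w => star (lift q (fun m u => star (qKernel q (m, u) (n, w))) ξ)
  map_add' ξ ξ' := by
    refine linearMap_ext fun n w => ?_
    simp only [lift_elem, map_add, star_add, LinearMap.add_apply]
  map_smul' c ξ := by
    refine linearMap_ext fun n w => ?_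
    simp only [lift_elem, map_smul, star_smul, LinearMap.smul_apply]
    rfl

theorem form_elem (n m : ℕ) (u w : ℕ → V) :
    form q V (elem q n u) (elem q m w) = qKernel q (n, u) (m, w) := by
  simp only [form, LinearMap.coe_mk, AddHom.coe_mk, lift_elem, star_star]

theorem form_create (f : V) (ξ η : PreFock q V) :
    form q V (create q f ξ) η = form q V ξ (annihilate q f η) := by
  induction ξ using induction_elem with
  | zero => simp
  | add ξ ξ' h h' => simp [h, h']
  | smul c n u =>
    induction η using induction_elem with
    | zero => simp
    | add η η' h h' => simp only [map_add, h, h']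
    | smul d m w =>
      simp only [map_smul, map_smulₛₗ, LinearMap.smul_apply]
      congr 2
      rw [create_elem, annihilate_elem, form_elem, map_sum]
      simp only [map_smul, form_elem]
      cases m with
      | zero => simp [qKernel]
      | succ m =>
        by_cases h : n = m
        · subst h
          simp [qKernel, qKernelOn_seqCons]
        · simp [qKernel, h]

theorem form_ofFinsupp (x y : ℕ × (ℕ → V) →₀ ℂ) : form q V (ofFinsupp q x) (ofFinsupp q y) =
    x.sum fun i a => y.sum fun j b => star a * qKernel q i j * b := by
  rw [Finsupp.sum_comm]
  simp only [form, LinearMap.coe_mk, AddHom.coe_mk, lift_ofFinsupp]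
  refine Finset.sum_congr rfl fun j _ => ?_
  simp [Finsupp.sum, Finset.mul_sum, mul_comm]

theorem form_self_nonneg (h₁ : -1 ≤ q) (h₂ : q ≤ 1) (ξ : PreFock q V) : 0 ≤ form q V ξ ξ := by
  obtain ⟨x, rfl⟩ : ∃ x, ofFinsupp q x = ξ := ⟨ξ, rfl⟩
  exact form_ofFinsupp x x ▸ (posSemidef_qKernel h₁ h₂).2 x

theorem conj_form (h₁ : -1 ≤ q) (h₂ : q ≤ 1) (ξ η : PreFock q V) :
    star (form q V η ξ) = form q V ξ η := by
  induction ξ using induction_elem with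
  | zero => simp
  | add ξ ξ' h h' => simp only [map_add, star_add, LinearMap.add_apply, h, h']
  | smul c n u =>
    induction η using induction_elem with
    | zero => simp
    | add η η' h h' => simp only [map_add, LinearMap.add_apply, star_add, h, h']
    | smul d m w =>
      simp only [map_smul, map_smulₛₗ, LinearMap.smul_apply, form_elem, star_smul]
      have := (posSemidef_qKernel (V := V) h₁ h₂).1.apply (n, u) (m, w)
      simp only [Matrix.of_apply] at this
      rw [this]
      simp
      ring
end PreFock

/-! ### Boundedness and the Fock representation -/

namespace PreFock

section
variable {V : Type*} {q : ℝ}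

/-- The vectors with at most `n` particles. -/
noncomputable def degreeLE (q : ℝ) (V : Type*) (n : ℕ) : Submodule ℂ (PreFock q V) :=
  Submodule.span ℂ {ξ | ∃ m ≤ n, ∃ u, ξ = elem q m u}

theorem elem_mem_degreeLE {m n : ℕ} (h : m ≤ n) (u : ℕ → V) : elem q m u ∈ degreeLE q V n :=
  Submodule.subset_span ⟨m, h, u, rfl⟩

theorem degreeLE_mono : Monotone (degreeLE q V) := fun _ _ h =>
  Submodule.span_mono fun _ ⟨m, hm, u, hu⟩ => ⟨m, hm.trans h, u, hu⟩

theorem exists_mem_degreeLE (ξ : PreFock q V) : ∃ n, ξ ∈ degreeLE q V n := by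
  induction ξ using induction_elem with
  | zero => exact ⟨0, zero_mem _⟩
  | add ξ η hξ hη =>
    obtain ⟨n, hn⟩ := hξ
    obtain ⟨m, hm⟩ := hη
    exact ⟨max n m, add_mem (degreeLE_mono (le_max_left n m) hn)
      (degreeLE_mono (le_max_right n m) hm)⟩
  | smul c n u => exact ⟨n, Submodule.smul_mem _ _ (elem_mem_degreeLE le_rfl u)⟩

end

variable {V : Type*} [NormedAddCommGroup V] [InnerProductSpace ℂ V] {q : ℝ}

theorem annihilate_mem_degreeLE (f : V) {n : ℕ} {ξ : PreFock q V}
    (h : ξ ∈ degreeLE q V (n + 1)) : annihilate q f ξ ∈ degreeLE q V n := by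
  suffices h' : degreeLE q V (n + 1) ≤ (degreeLE q V n).comap (annihilate q f) from h' h
  refine Submodule.span_le.2 ?_
  rintro _ ⟨m, hm, u, rfl⟩
  simp only [SetLike.mem_coe, Submodule.mem_comap, annihilate_elem]
  exact Submodule.sum_mem _ fun j _ => Submodule.smul_mem _ _ (elem_mem_degreeLE (by omega) _)

theorem annihilate_eq_zero (f : V) {ξ : PreFock q V} (h : ξ ∈ degreeLE q V 0) :
    annihilate q f ξ = 0 := by
  suffices h' : degreeLE q V 0 ≤ LinearMap.ker (annihilate q f) from h' h
  refine Submodule.span_le.2 ?_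
  rintro _ ⟨m, hm, u, rfl⟩
  obtain rfl := Nat.le_zero.1 hm
  simp [annihilate_elem]

theorem annihilate_create (f g : V) (ξ : PreFock q V) :
    annihilate q f (create q g ξ) = inner ℂ g f • ξ + (q : ℂ) • create q g (annihilate q f ξ) :=
  LinearMap.congr_fun (annihilate_comp_create f g) ξ

variable [h₁ : Fact (-1 < q)] [h₂ : Fact (q < 1)]

/-- The pre-inner product space structure of finite `q`-Fock vectors. -/
noncomputable abbrev core : PreInnerProductSpace.Core ℂ (PreFock q V) where
  inner ξ η := form q V ξ η
  conj_inner_symm ξ η := conj_form h₁.out.le h₂.out.le ξ η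
  re_inner_nonneg ξ := (Complex.le_def.1 (form_self_nonneg h₁.out.le h₂.out.le ξ)).1
  add_left ξ η ζ := by simp
  smul_left ξ η c := by simp

noncomputable instance : SeminormedAddCommGroup (PreFock q V) :=
  InnerProductSpace.Core.toSeminormedAddCommGroup (c := core)
noncomputable instance : InnerProductSpace ℂ (PreFock q V) := InnerProductSpace.ofCore core

theorem inner_eq_form (ξ η : PreFock q V) : inner ℂ ξ η = form q V ξ η := rfl

theorem inner_create (f : V) (ξ η : PreFock q V) :
    inner ℂ (create q f ξ) η = inner ℂ ξ (annihilate q f η) := form_create f ξ η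

theorem norm_create_sq (f : V) (ξ : PreFock q V) :
    ‖create q f ξ‖ ^ 2 = ‖f‖ ^ 2 * ‖ξ‖ ^ 2 + q * ‖annihilate q f ξ‖ ^ 2 := by
  have h : inner ℂ (create q f ξ) (create q f ξ) =
      inner ℂ f f * inner ℂ ξ ξ + (q : ℂ) * inner ℂ (annihilate q f ξ) (annihilate q f ξ) := by
    rw [inner_create, annihilate_create, inner_add_right, inner_smul_right, inner_smul_right,
      ← inner_conj_symm ξ (create q f _), inner_create, inner_conj_symm]
  simp only [inner_self_eq_norm_sq_to_K] at h
  refine Complex.ofReal_injective ?_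
  simpa using h

theorem one_sub_abs_pos (q : ℝ) [h₁ : Fact (-1 < q)] [h₂ : Fact (q < 1)] : 0 < 1 - |q| :=
  sub_pos.2 (abs_lt.2 ⟨h₁.out, h₂.out⟩)

/-- By adjointness and Cauchy–Schwarz, a bound for creation at the single vector `annihilate q f ξ`
yields one for annihilation at `ξ`. This pointwise form permits induction on the particle number. -/
theorem norm_annihilate_sq_le {f : V} {ξ : PreFock q V} {K : ℝ} (hK : 0 ≤ K)
    (h : ‖create q f (annihilate q f ξ)‖ ^ 2 ≤ K * ‖annihilate q f ξ‖ ^ 2) :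
    ‖annihilate q f ξ‖ ^ 2 ≤ K * ‖ξ‖ ^ 2 := by
  have h3 : ‖annihilate q f ξ‖ ^ 2 ≤ ‖create q f (annihilate q f ξ)‖ * ‖ξ‖ := by
    have := norm_inner_le_norm (𝕜 := ℂ) (create q f (annihilate q f ξ)) ξ
    rw [inner_create, inner_self_eq_norm_sq_to_K] at this
    simpa using this
  rcases (sq_nonneg ‖annihilate q f ξ‖).eq_or_lt with h0 | h0
  · rw [← h0]; positivity
  · have h4 := pow_le_pow_left₀ h0.le h3 2
    have h5 := mul_le_mul_of_nonneg_right h (sq_nonneg ‖ξ‖)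
    refine le_of_mul_le_mul_left ?_ h0
    linarith

/-- The constant `K = ‖f‖ ^ 2 / (1 - |q|)` solves `‖f‖ ^ 2 + |q| * K = K`, so the bound reproduces
itself as the degree rises; annihilation lowers the degree and vanishes in degree `0`. -/
theorem norm_create_sq_le (f : V) (ξ : PreFock q V) :
    ‖create q f ξ‖ ^ 2 ≤ ‖f‖ ^ 2 / (1 - |q|) * ‖ξ‖ ^ 2 := by
  have hq := one_sub_abs_pos q
  have hK : 0 ≤ ‖f‖ ^ 2 / (1 - |q|) := by positivity
  obtain ⟨n, hn⟩ := exists_mem_degreeLE ξ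
  have key : ∀ ξ : PreFock q V,
      ‖annihilate q f ξ‖ ^ 2 ≤ ‖f‖ ^ 2 / (1 - |q|) * ‖ξ‖ ^ 2 →
      ‖create q f ξ‖ ^ 2 ≤ ‖f‖ ^ 2 / (1 - |q|) * ‖ξ‖ ^ 2 := by
    intro ξ h
    have h1 : q * ‖annihilate q f ξ‖ ^ 2 ≤ |q| * (‖f‖ ^ 2 / (1 - |q|) * ‖ξ‖ ^ 2) :=
      (mul_le_mul_of_nonneg_right (le_abs_self q) (sq_nonneg _)).trans
        (mul_le_mul_of_nonneg_left h (abs_nonneg q))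
    calc ‖create q f ξ‖ ^ 2
        ≤ ‖f‖ ^ 2 * ‖ξ‖ ^ 2 + |q| * (‖f‖ ^ 2 / (1 - |q|) * ‖ξ‖ ^ 2) := by
          rw [norm_create_sq]; linarith
      _ = ‖f‖ ^ 2 / (1 - |q|) * ‖ξ‖ ^ 2 := by field_simp; ring
  induction n generalizing ξ with
  | zero =>
    refine key ξ ?_
    rw [annihilate_eq_zero f hn, norm_zero, zero_pow two_ne_zero]
    exact mul_nonneg hK (sq_nonneg _)
  | succ n ih => exact key ξ (norm_annihilate_sq_le hK (ih _ (annihilate_mem_degreeLE f hn)))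

/-- The annihilation operator as a bounded operator. -/
noncomputable def annihilateL (q : ℝ) [Fact (-1 < q)] [Fact (q < 1)] (f : V) :
    PreFock q V →L[ℂ] PreFock q V :=
  (annihilate q f).mkContinuous √(‖f‖ ^ 2 / (1 - |q|)) fun ξ => by
    have hK : 0 ≤ ‖f‖ ^ 2 / (1 - |q|) := div_nonneg (sq_nonneg _) (one_sub_abs_pos q).le
    refine le_of_sq_le_sq ?_ (by positivity)
    rw [mul_pow, Real.sq_sqrt hK]
    exact norm_annihilate_sq_le hK (norm_create_sq_le _ _)

/-- The creation operator as a bounded operator. -/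
noncomputable def createL (q : ℝ) [Fact (-1 < q)] [Fact (q < 1)] (f : V) :
    PreFock q V →L[ℂ] PreFock q V :=
  (create q f).mkContinuous √(‖f‖ ^ 2 / (1 - |q|)) fun ξ => by
    have hK : 0 ≤ ‖f‖ ^ 2 / (1 - |q|) := div_nonneg (sq_nonneg _) (one_sub_abs_pos q).le
    refine le_of_sq_le_sq ?_ (by positivity)
    rw [mul_pow, Real.sq_sqrt hK]
    exact norm_create_sq_le _ _

theorem annihilateL_apply (f : V) (ξ : PreFock q V) :
    annihilateL q f ξ = annihilate q f ξ := rfl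

theorem createL_apply (f : V) (ξ : PreFock q V) : createL q f ξ = create q f ξ := rfl

open UniformSpace Completion

/-- The annihilation operators on the `q`-Fock space, the completion of `PreFock q V`. -/
noncomputable def fockRep (q : ℝ) (V : Type*) [NormedAddCommGroup V] [InnerProductSpace ℂ V]
    [Fact (-1 < q)] [Fact (q < 1)] :
    V →ₗ[ℂ] (Completion (PreFock q V) →L[ℂ] Completion (PreFock q V)) where
  toFun f := (annihilateL q f).completion
  map_add' f g := by
    ext x
    induction x using induction_on with
    | hp => exact isClosed_eq (ContinuousLinearMap.continuous _) (ContinuousLinearMap.continuous _)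
    | ih x =>
      simp only [add_apply, ContinuousLinearMap.completion_apply_coe,
        annihilateL_apply, annihilate_add, LinearMap.add_apply, Completion.coe_add]
  map_smul' c f := by
    ext x
    induction x using induction_on with
    | hp => exact isClosed_eq (ContinuousLinearMap.continuous _) (ContinuousLinearMap.continuous _)
    | ih x =>
      simp only [smul_apply, ContinuousLinearMap.completion_apply_coe,
        annihilateL_apply, annihilate_smul, LinearMap.smul_apply, Completion.coe_smul,
        RingHom.id_apply]

theorem fockRep_apply (f : V) : fockRep q V f = (annihilateL q f).completion := rfl

theorem star_fockRep (f : V) : star (fockRep q V f) = (createL q f).completion := by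
  rw [ContinuousLinearMap.star_eq_adjoint]
  symm
  rw [ContinuousLinearMap.eq_adjoint_iff, fockRep_apply]
  intro x y
  induction x, y using induction_on₂ with
  | hp => apply isClosed_eq <;> fun_prop
  | ih x y =>
    rw [ContinuousLinearMap.completion_apply_coe, ContinuousLinearMap.completion_apply_coe,
      inner_coe, inner_coe]
    exact inner_create f x y

theorem isQRep_fockRep : IsQRep q (fockRep q V) := by
  intro f g
  rw [star_fockRep, fockRep_apply]
  ext x
  induction x using induction_on with
  | hp => exact isClosed_eq (ContinuousLinearMap.continuous _) (ContinuousLinearMap.continuous _)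
  | ih x =>
    simp only [sub_apply, smul_apply,
      mul_apply_eq_comp, one_apply_eq_self,
      ContinuousLinearMap.completion_apply_coe, annihilateL_apply, createL_apply,
      annihilate_create, Completion.coe_add, Completion.coe_smul, add_sub_cancel_right]

instance : Nontrivial (Completion (PreFock q V)) := by
  -- The vacuum has norm one: its kernel is a sum over the single permutation of the empty set.
  refine ⟨⟨(elem q 0 0 : PreFock q V), 0, fun h => ?_⟩⟩
  have h' := inner_coe (𝕜 := ℂ) (elem q 0 (0 : ℕ → V)) (elem q 0 0)
  rw [h, inner_zero_left, inner_eq_form, form_elem] at h'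
  simp [qKernel, qKernelOn, invWeight] at h'

end PreFock

theorem exists_nontrivial_isQRep {q : ℝ} (h₁ : -1 < q) (h₂ : q < 1) (V : Type u)
    [NormedAddCommGroup V] [InnerProductSpace ℂ V] :
    ∃ (A : Type u) (_ : CStarAlgebra A) (r : V →ₗ[ℂ] A), Nontrivial A ∧ IsQRep q r := by
  have := Fact.mk h₁
  have := Fact.mk h₂
  exact ⟨_, inferInstance, PreFock.fockRep q V, inferInstance, PreFock.isQRep_fockRep⟩

/-! ### A uniform norm bound and C⋆-algebraic tools -/

theorem IsQRep.norm_sq_le {V A : Type*} [NormedAddCommGroup V] [InnerProductSpace ℂ V]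
    [CStarAlgebra A] {q : ℝ} (h₁ : -1 < q) (h₂ : q < 1) {r : V →ₗ[ℂ] A} (hr : IsQRep q r) (f : V) :
    ‖r f‖ ^ 2 ≤ ‖f‖ ^ 2 / (1 - |q|) := by
  rcases subsingleton_or_nontrivial A with hA | hA
  · rw [Subsingleton.elim (r f) 0, norm_zero, zero_pow two_ne_zero]
    exact div_nonneg (sq_nonneg _) (sub_pos.2 (abs_lt.2 ⟨h₁, h₂⟩)).le
  rw [le_div_iff₀ (sub_pos.2 (abs_lt.2 ⟨h₁, h₂⟩))]
  have h : ‖r f‖ ^ 2 ≤ ‖f‖ ^ 2 + |q| * ‖r f‖ ^ 2 := by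
    calc ‖r f‖ ^ 2 = ‖r f * star (r f)‖ := by rw [CStarRing.norm_self_mul_star, sq]
      _ = ‖inner ℂ f f • (1 : A) + (q : ℂ) • (star (r f) * r f)‖ := by rw [← hr f f]; simp
      _ ≤ ‖inner ℂ f f • (1 : A)‖ + ‖(q : ℂ) • (star (r f) * r f)‖ := norm_add_le _ _
      _ = ‖f‖ ^ 2 + |q| * ‖r f‖ ^ 2 := by
        rw [norm_smul, norm_smul, CStarRing.norm_star_mul_self, inner_self_eq_norm_sq_to_K]
        simp [sq]
  linarith

/-- Transport of the structure of a unital C⋆-algebra along a bijection. -/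
noncomputable abbrev Equiv.cstarAlgebra {S A : Type*} [CStarAlgebra A] (e : S ≃ A) :
    CStarAlgebra S :=
  letI : Ring S := e.ring
  letI : Algebra ℂ S := e.algebra ℂ
  letI : StarRing S := e.starRing
  letI : NormedRing S := NormedRing.induced S A (e.ringEquiv : S ≃+* A) e.injective
  letI : NormedAlgebra ℂ S := NormedAlgebra.induced ℂ S A (e.algEquiv ℂ)
  { star_smul := fun c x => (e.starModule ℂ).star_smul c x
    norm_mul_self_le := fun x => by
      have h : e (star x * x) = star (e x) * e x :=
        (e.apply_symm_apply _).trans (congrArg (· * e x) (e.apply_symm_apply _))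
      change ‖e x‖ * ‖e x‖ ≤ ‖e (star x * x)‖
      rw [h, CStarRing.norm_star_mul_self]
    toCompleteSpace :=
      (completeSpace_congr (e := e) (isUniformEmbedding_comap e.injective)).2 inferInstance }

theorem Equiv.exists_cstarAlgebra {S A : Type*} [CStarAlgebra A] (e : S ≃ A) :
    ∃ _ : CStarAlgebra S, Nonempty (S ≃⋆ₐ[ℂ] A) :=
  ⟨e.cstarAlgebra,
    letI := e.cstarAlgebra
    ⟨{ e with
      map_mul' := fun _ _ => e.apply_symm_apply _
      map_add' := fun _ _ => e.apply_symm_apply _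
      map_star' := fun _ => e.apply_symm_apply _
      map_smul' := fun _ _ => e.apply_symm_apply _ }⟩⟩

noncomputable instance {ι : Type*} {A : ι → Type*} [∀ i, Nontrivial (A i)]
    [∀ i, CStarAlgebra (A i)] : CStarAlgebra (lp A ∞) where

/-- Evaluation at an index, as a unital `⋆`-homomorphism on a product of C⋆-algebras. -/
noncomputable def lpEval {ι : Type*} (A : ι → Type*) [∀ i, Nontrivial (A i)]
    [∀ i, CStarAlgebra (A i)] (i : ι) : lp A ∞ →⋆ₐ[ℂ] A i where
  toFun a := a i
  map_one' := rfl
  map_mul' _ _ := rfl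
  map_zero' := rfl
  map_add' _ _ := rfl
  commutes' _ := rfl
  map_star' _ := rfl

/-- The C⋆-subalgebra generated by a set. -/
noncomputable abbrev cstarClosure {A : Type*} [CStarAlgebra A] (s : Set A) : StarSubalgebra ℂ A :=
  (StarAlgebra.adjoin ℂ s).topologicalClosure

instance {A : Type*} [CStarAlgebra A] (s : Set A) : IsClosed (cstarClosure s : Set A) :=
  StarSubalgebra.isClosed_topologicalClosure _

theorem subset_cstarClosure {A : Type*} [CStarAlgebra A] (s : Set A) : s ⊆ cstarClosure s :=
  (StarAlgebra.subset_adjoin ℂ s).trans (StarSubalgebra.le_topologicalClosure _)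

theorem cstarClosure_hom_ext {A B : Type*} [CStarAlgebra A] [CStarAlgebra B] {s : Set A}
    {φ ψ : cstarClosure s →⋆ₐ[ℂ] B}
    (h : ∀ x (hx : x ∈ s), φ ⟨x, subset_cstarClosure s hx⟩ = ψ ⟨x, subset_cstarClosure s hx⟩) :
    φ = ψ := by
  refine StarAlgHom.ext_topologicalClosure (map_continuous φ) (map_continuous ψ) ?_
  refine StarAlgHom.ext_adjoin fun x hx => h x hx

/-- Each element is the limit of a sequence of noncommutative polynomials in the generators and
their adjoints. A chosen sequence determines it by uniqueness of limits. The target depends on `X`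
alone, not on `A` or its universe. -/
theorem exists_injective_cstarClosure {X : Type u} {A : Type w} [CStarAlgebra A] (s : X → A) :
    ∃ g : cstarClosure (Set.range s) → (ℕ → FreeAlgebra ℂ (X ⊕ X)), Function.Injective g := by
  have h : ∀ b : cstarClosure (Set.range s), ∃ x : ℕ → FreeAlgebra ℂ (X ⊕ X),
      Filter.Tendsto (fun n => FreeAlgebra.lift ℂ (Sum.elim s (star ∘ s)) (x n)) Filter.atTop
        (nhds (b : A)) := by
    intro b
    obtain ⟨y, hy, hb⟩ := mem_closure_iff_seq_limit.1 b.2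
    have hy' : ∀ n, ∃ x, FreeAlgebra.lift ℂ (Sum.elim s (star ∘ s)) x = y n := by
      intro n
      have h1 : y n ∈ Algebra.adjoin ℂ (Set.range s ∪ star (Set.range s)) := hy n
      have h2 : Set.range s ∪ star (Set.range s) = Set.range (Sum.elim s (star ∘ s)) := by
        rw [Set.Sum.elim_range, Set.range_comp, Set.image_star]
      rw [h2, Algebra.adjoin_range_eq_range_freeAlgebra_lift] at h1
      exact h1
    choose x hx using hy'
    exact ⟨x, by simpa only [hx] using hb⟩
  choose g hg using h
  exact ⟨g, fun a b hab => Subtype.ext (tendsto_nhds_unique (hg a) (hab ▸ hg b))⟩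

/-! ### Construction of the universal representation -/

theorem IsQRep.comp {V A B : Type*} [NormedAddCommGroup V] [InnerProductSpace ℂ V]
    [CStarAlgebra A] [CStarAlgebra B] {q : ℝ} {r : V →ₗ[ℂ] A} (hr : IsQRep q r) (φ : A →⋆ₐ[ℂ] B) :
    IsQRep q (φ.toAlgHom.toLinearMap ∘ₗ r) := by
  intro f g
  have h := congrArg φ (hr f g)
  simp only [map_sub, map_mul, map_smul, map_star, map_one] at h
  exact h

theorem IsQRep.of_comp {V A B : Type*} [NormedAddCommGroup V] [InnerProductSpace ℂ V]
    [CStarAlgebra A] [CStarAlgebra B] {q : ℝ} {r : V →ₗ[ℂ] A} {φ : A →⋆ₐ[ℂ] B}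
    (hφ : Function.Injective φ) {s : V →ₗ[ℂ] B} (hs : IsQRep q s) (h : ∀ f, φ (r f) = s f) :
    IsQRep q r := by
  intro f g
  apply hφ
  simpa only [map_sub, map_mul, map_smul, map_star, map_one, h] using hs f g

/-- Representations of the `q`-relations in nonzero C⋆-algebras carried by subsets of a type that
is large enough for all C⋆-algebras generated by such a representation. -/
structure SmallQRep (q : ℝ) (V : Type u) [NormedAddCommGroup V] [InnerProductSpace ℂ V] where
  carrier : Set (ℕ → FreeAlgebra ℂ (V ⊕ V))
  [cstarAlgebra : CStarAlgebra carrier]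
  [nontrivial : Nontrivial carrier]
  rep : V →ₗ[ℂ] carrier
  isQRep : IsQRep q rep

namespace SmallQRep
attribute [instance] cstarAlgebra nontrivial

variable {q : ℝ} {V : Type u} [NormedAddCommGroup V] [InnerProductSpace ℂ V]

/-- The C⋆-algebra generated by the range of `s` is transported to a set of sequences, then mapped
back into `A`. -/
theorem exists_hom {A : Type w} [CStarAlgebra A] [Nontrivial A] {s : V →ₗ[ℂ] A}
    (hs : IsQRep q s) :
    ∃ (i : SmallQRep q V) (φ : i.carrier →⋆ₐ[ℂ] A), ∀ f, φ (i.rep f) = s f := by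
  obtain ⟨g, hg⟩ := exists_injective_cstarClosure (s : V → A)
  obtain ⟨_, ⟨φ⟩⟩ := (Equiv.ofInjective g hg).symm.exists_cstarAlgebra
  let B := cstarClosure (Set.range s)
  let t : V →ₗ[ℂ] B := s.codRestrict B.toSubalgebra.toSubmodule fun f =>
    subset_cstarClosure _ ⟨f, rfl⟩
  have ht : IsQRep q t := hs.of_comp (φ := B.subtype) Subtype.val_injective fun f => rfl
  have : Nontrivial (Set.range g) := φ.toEquiv.nontrivial
  exact ⟨⟨Set.range g, _, ht.comp (φ.symm : B →⋆ₐ[ℂ] Set.range g)⟩,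
    B.subtype.comp (φ : Set.range g →⋆ₐ[ℂ] B), fun f => congrArg Subtype.val (φ.apply_symm_apply _)⟩

/-- The direct sum of all small representations. -/
noncomputable def sum (h₁ : -1 < q) (h₂ : q < 1) :
    V →ₗ[ℂ] lp (fun i : SmallQRep q V => i.carrier) ∞ where
  toFun f := ⟨fun i => i.rep f, memℓp_infty ⟨√(‖f‖ ^ 2 / (1 - |q|)), by
    rintro _ ⟨i, rfl⟩
    exact Real.le_sqrt_of_sq_le (i.isQRep.norm_sq_le h₁ h₂ f)⟩⟩
  map_add' f g := lp.ext (funext fun i => map_add i.rep f g)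
  map_smul' c f := lp.ext (funext fun i => map_smul i.rep c f)

theorem isQRep_sum (h₁ : -1 < q) (h₂ : q < 1) : IsQRep q (sum (V := V) h₁ h₂) := by
  intro f g
  refine lp.ext (funext fun i => ?_)
  exact i.isQRep f g

/-- The representation in the C⋆-algebra generated by the direct sum of all small
representations. -/
noncomputable def universalRep (h₁ : -1 < q) (h₂ : q < 1) :
    V →ₗ[ℂ] cstarClosure (Set.range (sum (V := V) h₁ h₂)) :=
  (sum h₁ h₂).codRestrict (cstarClosure _).toSubalgebra.toSubmodule fun f =>
    subset_cstarClosure _ ⟨f, rfl⟩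

theorem isUniversalQRep_universalRep (h₁ : -1 < q) (h₂ : q < 1) :
    IsUniversalQRep.{w} q (universalRep (V := V) h₁ h₂) := by
  refine ⟨(isQRep_sum h₁ h₂).of_comp (φ := (cstarClosure _).subtype) Subtype.val_injective
    fun f => rfl, fun A _ s hs => ?_⟩
  refine existsUnique_of_exists_of_unique ?_ fun φ ψ hφ hψ => cstarClosure_hom_ext ?_
  -- Carriers of `SmallQRep` are nonzero, so the zero algebra is treated apart; a nonzero target is
  -- reached by evaluating the direct sum at one index.
  · rcases subsingleton_or_nontrivial A with hA | hA
    · exact ⟨{ toFun := 0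
               map_one' := Subsingleton.elim _ _
               map_mul' := fun _ _ => Subsingleton.elim _ _
               map_zero' := rfl
               map_add' := fun _ _ => Subsingleton.elim _ _
               commutes' := fun _ => Subsingleton.elim _ _
               map_star' := fun _ => Subsingleton.elim _ _ }, fun _ => Subsingleton.elim _ _⟩
    · obtain ⟨i, φ, hφ⟩ := exists_hom hs
      exact ⟨φ.comp ((lpEval (fun i : SmallQRep q V => i.carrier) i).comp (cstarClosure _).subtype),
        hφ⟩
  · rintro _ ⟨f, rfl⟩
    exact (hφ f).trans (hψ f).symm

end SmallQRep

/-! ### Consequences of universality -/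

theorem IsUniversalQRep.nontrivial {q : ℝ} (h₁ : -1 < q) (h₂ : q < 1) {V : Type u}
    {C : Type*} [NormedAddCommGroup V] [InnerProductSpace ℂ V] [CStarAlgebra C] {r : V →ₗ[ℂ] C}
    (hr : IsUniversalQRep.{u} q r) : Nontrivial C := by
  obtain ⟨A, _, s, _, hs⟩ := exists_nontrivial_isQRep h₁ h₂ V
  obtain ⟨β, -⟩ := (hr.2 A s hs).exists
  exact β.toRingHom.domain_nontrivial

theorem IsUniversalQRep.hom_ext {q : ℝ} {V : Type u} {C : Type*} {A : Type w}
    [NormedAddCommGroup V] [InnerProductSpace ℂ V] [CStarAlgebra C] [CStarAlgebra A]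
    {r : V →ₗ[ℂ] C} (hr : IsUniversalQRep.{w} q r) {φ ψ : C →⋆ₐ[ℂ] A}
    (h : ∀ f, φ (r f) = ψ (r f)) : φ = ψ :=
  (hr.2 A _ (hr.1.comp ψ)).unique h fun _ => rfl

theorem mainTheorem4 (q : ℝ) (hq₁ : -1 < q) (hq₂ : q < 1) :
    -- existence: a nonzero unital C⋆-algebra (in the universe of `V`) with a representation that
    -- is universal for the C⋆-algebras of that universe and of any other universe `w`
    (∀ (V : Type u) [NormedAddCommGroup V] [InnerProductSpace ℂ V] [CompleteSpace V],
      ∃ (C : Type u) (_ : CStarAlgebra C) (r : V →ₗ[ℂ] C),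
        Nontrivial C ∧ IsUniversalQRep.{u} q r ∧ IsUniversalQRep.{w} q r) ∧
    -- uniqueness up to a (unique) C⋆-isomorphism that respects the generators
    (∀ (V : Type u) [NormedAddCommGroup V] [InnerProductSpace ℂ V] [CompleteSpace V]
      (C₁ C₂ : Type w) [CStarAlgebra C₁] [CStarAlgebra C₂]
      (r₁ : V →ₗ[ℂ] C₁) (r₂ : V →ₗ[ℂ] C₂),
      IsUniversalQRep.{w} q r₁ → IsUniversalQRep.{w} q r₂ →
        ∃! φ : C₁ ≃⋆ₐ[ℂ] C₂, ∀ f : V, φ (r₁ f) = r₂ f) ∧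
    -- every linear isometry induces a unique `⋆`-homomorphism
    (∀ (V₁ V₂ : Type u)
      [NormedAddCommGroup V₁] [InnerProductSpace ℂ V₁] [CompleteSpace V₁]
      [NormedAddCommGroup V₂] [InnerProductSpace ℂ V₂] [CompleteSpace V₂]
      (C₁ C₂ : Type w) [CStarAlgebra C₁] [CStarAlgebra C₂]
      (r₁ : V₁ →ₗ[ℂ] C₁) (r₂ : V₂ →ₗ[ℂ] C₂),
      IsUniversalQRep.{w} q r₁ → IsUniversalQRep.{w} q r₂ →
      ∀ H : V₁ →ₗᵢ[ℂ] V₂, ∃! Φ : C₁ →⋆ₐ[ℂ] C₂, ∀ f : V₁, Φ (r₁ f) = r₂ (H f)) ∧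
    -- the homomorphism induced by the identity is the identity
    (∀ (V : Type u) [NormedAddCommGroup V] [InnerProductSpace ℂ V] [CompleteSpace V]
      (C : Type w) [CStarAlgebra C] (r : V →ₗ[ℂ] C),
      IsUniversalQRep.{w} q r →
      ∀ Φ : C →⋆ₐ[ℂ] C,
        (∀ f : V, Φ (r f) = r ((LinearIsometry.id : V →ₗᵢ[ℂ] V) f)) → Φ = StarAlgHom.id ℂ C) ∧
    -- the homomorphism induced by a composite is the composite of the induced homomorphisms
    (∀ (V₁ V₂ V₃ : Type u)
      [NormedAddCommGroup V₁] [InnerProductSpace ℂ V₁] [CompleteSpace V₁]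
      [NormedAddCommGroup V₂] [InnerProductSpace ℂ V₂] [CompleteSpace V₂]
      [NormedAddCommGroup V₃] [InnerProductSpace ℂ V₃] [CompleteSpace V₃]
      (C₁ C₂ C₃ : Type w) [CStarAlgebra C₁] [CStarAlgebra C₂] [CStarAlgebra C₃]
      (r₁ : V₁ →ₗ[ℂ] C₁) (r₂ : V₂ →ₗ[ℂ] C₂) (r₃ : V₃ →ₗ[ℂ] C₃),
      IsUniversalQRep.{w} q r₁ → IsUniversalQRep.{w} q r₂ → IsUniversalQRep.{w} q r₃ →
      ∀ (H : V₁ →ₗᵢ[ℂ] V₂) (K : V₂ →ₗᵢ[ℂ] V₃)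
        (Φ : C₁ →⋆ₐ[ℂ] C₂) (Ψ : C₂ →⋆ₐ[ℂ] C₃) (Θ : C₁ →⋆ₐ[ℂ] C₃),
        (∀ f : V₁, Φ (r₁ f) = r₂ (H f)) → (∀ f : V₂, Ψ (r₂ f) = r₃ (K f)) →
        (∀ f : V₁, Θ (r₁ f) = r₃ ((K.comp H) f)) → Θ = Ψ.comp Φ) := by
  refine ⟨?_, ?_, ?_, ?_, ?_⟩
  · intro V _ _ _
    have h : IsUniversalQRep.{u} q (SmallQRep.universalRep (V := V) hq₁ hq₂) :=
      SmallQRep.isUniversalQRep_universalRep hq₁ hq₂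
    exact ⟨_, inferInstance, SmallQRep.universalRep hq₁ hq₂, h.nontrivial hq₁ hq₂, h,
      SmallQRep.isUniversalQRep_universalRep hq₁ hq₂⟩
  · intro V _ _ _ C₁ C₂ _ _ r₁ r₂ h₁ h₂
    obtain ⟨φ, hφ⟩ := (h₁.2 C₂ r₂ h₂.1).exists
    obtain ⟨ψ, hψ⟩ := (h₂.2 C₁ r₁ h₁.1).exists
    refine ⟨StarAlgEquiv.ofStarAlgHom φ ψ (h₁.hom_ext fun f => ?_) (h₂.hom_ext fun f => ?_),
      hφ, fun φ' hφ' => StarAlgEquiv.ext fun x => ?_⟩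
    · simp [hφ, hψ]
    · simp [hφ, hψ]
    · have h : (φ' : C₁ →⋆ₐ[ℂ] C₂) = φ := h₁.hom_ext fun f => (hφ' f).trans (hφ f).symm
      exact congrArg (fun χ : C₁ →⋆ₐ[ℂ] C₂ => χ x) h
  · intro V₁ V₂ _ _ _ _ _ _ C₁ C₂ _ _ r₁ r₂ h₁ h₂ H
    -- An isometry preserves inner products, so `r₂ ∘ H` again satisfies the `q`-relations.
    exact h₁.2 C₂ (r₂ ∘ₗ H.toLinearMap) fun f g => by
      simpa using h₂.1 (H f) (H g)
  · intro V _ _ _ C _ r hr Φ hΦ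
    exact hr.hom_ext hΦ
  · intro V₁ V₂ V₃ _ _ _ _ _ _ _ _ _ C₁ C₂ C₃ _ _ _ r₁ r₂ r₃ h₁ h₂ h₃ H K Φ Ψ Θ hΦ hΨ hΘ
    refine h₁.hom_ext fun f => ?_
    rw [hΘ, StarAlgHom.comp_apply, hΦ, hΨ, LinearIsometry.coe_comp, Function.comp_apply]
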